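/- All Banach spaces are real. For Banach spaces $X,Y$, write $\operatorname{Ext}(X,Y)=0$ if every exact sequence $0\to Y\to E\to X\to 0$ of Banach spaces and bounded operators splits, i.e. is equivalent to $0\to Y\to Y\oplus X\to X\to 0$. A map $F:X\to\mathbb R$ is $z$-linear if it is homogeneous ($F(cx)=cF(x)$ for $c\in\mathbb R$) and for some $C\ge 0$ one has $|F(\sum_{i=1}^n z_i)-\sum_{i=1}^n F(z_i)|\le C\sum_{i=1}^n\|z_i\|$ for all finite families $z_1,\dots,z_n\in X$; the infimum of such $C$ is $Z(F)$. Let $Z(X,\mathbb R)$ be the space of all such maps and $X'$ the algebraic dual of $X$. A metric projection on $X$ is a map $m:Z(X,\mathbb R)\to X'$ for which there is a constant $\lambda$ with $\sup_{\|x\|\le 1}|F(x)-m(F)(x)|\le\lambda Z(F)$ for all $F$; it is $w^*$-continuous at $0$ if $m(F_\alpha)\to m(0)$ pointwise on $X$ whenever $(F_\alpha)$ is a net in $\{F: Z(F)\le 1\}$ that converges to $0$ pointwise on $X$. There is a nonseparable Banach space $Z$ with the following property. There exist exact sequences $0\to K(Z)\to\ell_1(\Gamma)\xrightarrow{Q}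 Z\to 0$ of Banach spaces, and for every such sequence (for any set $\Gamma$ and any bounded linear surjection $Q$), the subspace $K(Z)=\ker Q$ of $\ell_1(\Gamma)$ satisfies $\operatorname{Ext}(K(Z),c_0)\neq 0$, and $K(Z)$ admits no metric projection that is $w^*$-continuous at $0$. -/

import Mathlib

open scoped ZeroAtInfty Topology

namespace BanachExt

section Ext

variable {X Y E E' : Type*}
  [NormedAddCommGroup X] [NormedSpace ℝ X] [NormedAddCommGroup Y] [NormedSpace ℝ Y]
  [NormedAddCommGroup E] [NormedSpace ℝ E] [NormedAddCommGroup E'] [NormedSpace ℝ E']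

/-- `0 → Y → E → X → 0` (with arrows `j`, `q`) is an exact sequence: the kernel of each arrow is
the image of the preceding one. -/
def IsShortExact (j : Y →L[ℝ] E) (q : E →L[ℝ] X) : Prop :=
  Function.Injective j ∧ Function.Exact j q ∧ Function.Surjective q

/-- Equivalence of the extensions `0 → Y → E → X → 0` and `0 → Y → E' → X → 0`: an operator
`T : E → E'` making the diagram commute (for Banach spaces it is then an isomorphism). -/
def EquivalentExt (j : Y →L[ℝ] E) (q : E →L[ℝ] X) (j' : Y →L[ℝ] E') (q' : E' →L[ℝ] X) : Prop :=
  ∃ T : E →L[ℝ] E', T.comp j = j' ∧ q'.comp T = q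

/-- The extension splits: it is equivalent to the trivial one `0 → Y → Y ⊕ X → X → 0`. -/
def Splits (j : Y →L[ℝ] E) (q : E →L[ℝ] X) : Prop :=
  EquivalentExt j q (ContinuousLinearMap.inl ℝ Y X) (ContinuousLinearMap.snd ℝ Y X)

end Ext

universe u v

/-- `Ext(X, Y) = 0`: every exact sequence `0 → Y → E → X → 0` with `E` a Banach space splits.
(The underlying set of such an `E` is in bijection with `Y × X`, so the universe of `E` is no
restriction.) -/
def ExtEqZero (X : Type u) (Y : Type v) [NormedAddCommGroup X] [NormedSpace ℝ X]
    [NormedAddCommGroup Y] [NormedSpace ℝ Y] : Prop :=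
  ∀ (E : Type (max u v)) [NormedAddCommGroup E] [NormedSpace ℝ E] [CompleteSpace E]
    (j : Y →L[ℝ] E) (q : E →L[ℝ] X), IsShortExact j q → Splits j q

section ZLinear

variable (X Y : Type*) [NormedAddCommGroup X] [NormedSpace ℝ X]
  [NormedAddCommGroup Y] [NormedSpace ℝ Y]

/-- `F` satisfies the z-linearity estimate with constant `C`. -/
def ZBound {X Y : Type*} [NormedAddCommGroup X] [NormedAddCommGroup Y]
    (F : X → Y) (C : ℝ) : Prop :=
  ∀ (n : ℕ) (z : Fin n → X), ‖F (∑ i, z i) - ∑ i, F (z i)‖ ≤ C * ∑ i, ‖z i‖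

/-- The space `Z(X, Y)` of z-linear maps `X → Y`, as mere functions. As a subspace of the product
`X → Y` it carries, for `Y = ℝ`, the `w*` topology of pointwise convergence. -/
def ZLinear : Submodule ℝ (X → Y) where
  carrier := {F | (∀ (c : ℝ) (x : X), F (c • x) = c • F x) ∧ ∃ C : ℝ, ZBound F C}
  zero_mem' := ⟨fun c x => by simp, 0, fun n z => by simp⟩
  add_mem' := by
    rintro F G ⟨hF, C, hC⟩ ⟨hG, D, hD⟩
    refine ⟨fun c x => by simp [hF, hG], C + D, fun n z => ?_⟩
    have h : (F + G) (∑ i, z i) - ∑ i, (F + G) (z i)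
        = (F (∑ i, z i) - ∑ i, F (z i)) + (G (∑ i, z i) - ∑ i, G (z i)) := by
      simp only [Pi.add_apply, Finset.sum_add_distrib]
      abel
    rw [h, add_mul]
    exact (norm_add_le _ _).trans (add_le_add (hC n z) (hD n z))
  smul_mem' := by
    rintro a F ⟨hF, C, hC⟩
    refine ⟨fun c x => by simp [hF, smul_comm a c], ‖a‖ * C, fun n z => ?_⟩
    have h : (a • F) (∑ i, z i) - ∑ i, (a • F) (z i) = a • (F (∑ i, z i) - ∑ i, F (z i)) := by
      simp only [Pi.smul_apply, Finset.smul_sum, smul_sub]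
    rw [h, norm_smul, mul_assoc]
    exact mul_le_mul_of_nonneg_left (hC n z) (norm_nonneg a)

variable {X Y}

/-- The constant `Z(F)` of z-linearity. (Asking for `0 ≤ C` matters only for `X = 0`.) -/
noncomputable def zConst (F : X → Y) : ℝ := sInf {C : ℝ | 0 ≤ C ∧ ZBound F C}

/-- `m : Z(X, ℝ) → X'`, with `X'` the algebraic dual, is a metric projection: for some `lam`,
`sup {|F x - m(F) x| : ‖x‖ ≤ 1} ≤ lam * Z(F)` for all `F`. -/
def IsMetricProjection (m : ZLinear X ℝ → Module.Dual ℝ X) : Prop :=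
  ∃ lam : ℝ, ∀ (F : ZLinear X ℝ) (x : X), ‖x‖ ≤ 1 →
    |F.1 x - m F x| ≤ lam * zConst F.1

/-- `m` is `w*`-continuous at `0`: it maps nets of the unit ball `{F | Z(F) ≤ 1}` that converge
pointwise to `0` to nets that converge pointwise to `m(0)`. -/
def WStarContinuousAtZero (m : ZLinear X ℝ → Module.Dual ℝ X) : Prop :=
  ContinuousWithinAt (fun F : ZLinear X ℝ => (m F : X → ℝ)) {F | zConst F.1 ≤ 1} 0

variable (X) in
/-- `X` admits a metric projection that is `w*`-continuous at `0`. -/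
def AdmitsMetricProjectionWStarContAtZero : Prop :=
  ∃ m : ZLinear X ℝ → Module.Dual ℝ X, IsMetricProjection m ∧ WStarContinuousAtZero m

end ZLinear

/-- The Banach space `ℓ₁(Γ)`. -/
abbrev l1 (Γ : Type*) : Type _ := lp (fun _ : Γ => ℝ) 1

/-- The Banach space `c₀` of null sequences with the sup norm: the functions on the discrete
space `ℕ` that vanish at infinity. -/
abbrev c0 : Type := C₀(ℕ, ℝ)

end BanachExt

/-! Identify `ℓ_∞/c₀` with its image `R` in `ℓ_∞(ℕ*)`, where `ℕ*` is the set of free ultrafilters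
and `π` takes limits along them, and let `Z = ℓ_∞(ℕ*)/R`. If `Ext(ker Q, c₀) = 0`, a lift of `Q` to
`ℓ_∞(ℕ*)` sends `ker Q` into `R`. There it lifts through `π` to `ℓ_∞`, and this lift extends to
`ℓ₁(Γ)` by injectivity of `ℓ_∞`. Subtracting the extension gives a section of `ℓ_∞(ℕ*) → Z`
(`exists_section_of_extEqZero_ker`), so `R` would be complemented.

It is not. An almost disjoint family of continuum many sets gives `τ : ℓ_∞(𝔠) → ℓ_∞(ℕ*)` sending
unit vectors into `R`. A projection onto `R` composed with `τ` fixes their images, so Rosenthal's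
disjointification gives it at least `2^𝔠` values (`mk_set_le_mk_range`), while `R` has at most `𝔠`
elements.

The claim on metric projections follows from `extEqZero_c0_of_admitsMetricProjection`: a projection
`w*`-continuous at `0` would force `Ext(ker Q, c₀) = 0`. -/

namespace BanachExt

/-! ### Metric projections and extensions by `c₀`. -/

section MetricProjection

theorem exists_homogeneous_rightInverse {E X : Type*} [NormedAddCommGroup E] [NormedSpace ℝ E]
    [CompleteSpace E] [NormedAddCommGroup X] [NormedSpace ℝ X] [CompleteSpace X]
    (q : E →L[ℝ] X) (hq : Function.Surjective q) :
    ∃ (B : X → E) (C : ℝ), 0 ≤ C ∧ (∀ x, q (B x) = x) ∧ (∀ x, ‖B x‖ ≤ C * ‖x‖) ∧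
      ∀ (c : ℝ) (x : X), B (c • x) = c • B x := by
  obtain ⟨C, hC, h⟩ := q.exists_preimage_norm_le hq
  choose g hg hgn using h
  let H : X → E := fun x => ‖x‖ • g (‖x‖⁻¹ • x)
  have hH (x : X) : q (H x) = x := by
    by_cases hx : x = 0
    · simp [H, hx]
    · simp [H, hg, smul_smul, hx]
  have hHn (x : X) : ‖H x‖ ≤ C * ‖x‖ := by
    by_cases hx : x = 0
    · simp [H, hx]
    · have h1 : ‖g (‖x‖⁻¹ • x)‖ ≤ C := by
        simpa [norm_smul, hx] using hgn (‖x‖⁻¹ • x)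
      simp only [H, norm_smul, norm_norm]
      rw [mul_comm]
      gcongr
  have hHc (c : ℝ) (hc : 0 < c) (x : X) : H (c • x) = c • H x := by
    simp only [H, norm_smul, Real.norm_of_nonneg hc.le, smul_smul, mul_inv]
    congr 3
    field_simp
  have hH0 : H 0 = 0 := by simp [H]
  -- `H` is only positively homogeneous; its odd part is homogeneous and still a right inverse.
  let B : X → E := fun x => (1 / 2 : ℝ) • (H x - H (-x))
  have hBneg (x : X) : B (-x) = - B x := by
    simp only [B, neg_neg, ← smul_neg, neg_sub]
  have hBpos (c : ℝ) (hc : 0 < c) (x : X) : B (c • x) = c • B x := by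
    simp only [B, ← smul_neg, hHc c hc, ← smul_sub]
    rw [smul_comm]
  refine ⟨B, C, hC.le, fun x => ?_, fun x => ?_, fun c x => ?_⟩
  · simp only [B, map_smul, map_sub, hH, sub_neg_eq_add, ← two_smul ℝ x, smul_smul]
    norm_num
  · simp only [B, norm_smul]
    have h1 := norm_sub_le (H x) (H (-x))
    have h2 := hHn x
    have h3 := hHn (-x)
    rw [norm_neg] at h3
    norm_num
    linarith
  · rcases lt_trichotomy c 0 with hc | rfl | hc
    · have : c • x = -((-c) • x) := by simp
      rw [this, hBneg, hBpos _ (neg_pos.2 hc)]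
      simp
    · simp [B, hH0]
    · exact hBpos c hc x

theorem splits_of_section {X Y E : Type*}
    [NormedAddCommGroup X] [NormedSpace ℝ X] [CompleteSpace X]
    [NormedAddCommGroup Y] [NormedSpace ℝ Y] [CompleteSpace Y]
    [NormedAddCommGroup E] [NormedSpace ℝ E] [CompleteSpace E]
    {j : Y →L[ℝ] E} {q : E →L[ℝ] X} (h : IsShortExact j q) (s : X →L[ℝ] E)
    (hs : ∀ x, q (s x) = x) : Splits j q := by
  obtain ⟨hj, hex, -⟩ := h
  have hqj (y : Y) : q (j y) = 0 := (hex _).2 ⟨y, rfl⟩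
  let S : Y × X →L[ℝ] E := j.coprod s
  have hS (a : Y × X) : S a = j a.1 + s a.2 := rfl
  have hqS (a : Y × X) : q (S a) = a.2 := by simp [hS, hqj, hs]
  have hinj : Function.Injective S := by
    rintro ⟨y, x⟩ ⟨y', x'⟩ hxy
    have h2 : x = x' := by simpa [hqS] using congrArg q hxy
    subst h2
    simp only [hS, add_left_inj] at hxy
    rw [hj hxy]
  have hsurj : Function.Surjective S := fun e => by
    obtain ⟨y, hy⟩ := (hex (e - s (q e))).1 (by simp [hs])
    exact ⟨(y, q e), by simp [hS, hy]⟩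
  let T := ContinuousLinearEquiv.ofBijective S (LinearMap.ker_eq_bot.2 hinj)
    (LinearMap.range_eq_top.2 hsurj)
  have hT (a : Y × X) : T a = S a := rfl
  refine ⟨T.symm.toContinuousLinearMap, ?_, ?_⟩
  · ext1 y
    simp only [ContinuousLinearMap.comp_apply, ContinuousLinearEquiv.coe_coe,
      ContinuousLinearMap.inl_apply]
    rw [ContinuousLinearEquiv.symm_apply_eq, hT, hS]
    simp
  · ext1 e
    obtain ⟨a, rfl⟩ := hsurj e
    rw [hqS, ← hT]
    simp

theorem exists_norm_le_of_isShortExact {X Y E : Type*}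
    [NormedAddCommGroup X] [NormedSpace ℝ X]
    [NormedAddCommGroup Y] [NormedSpace ℝ Y] [CompleteSpace Y]
    [NormedAddCommGroup E] [NormedSpace ℝ E] [CompleteSpace E]
    {j : Y →L[ℝ] E} {q : E →L[ℝ] X} (h : IsShortExact j q) :
    ∃ C : ℝ, 0 ≤ C ∧ ∀ y, ‖y‖ ≤ C * ‖j y‖ := by
  obtain ⟨hj, hex, -⟩ := h
  have hmem (y : Y) : j y ∈ LinearMap.ker q.toLinearMap := (hex _).2 ⟨y, rfl⟩
  have : CompleteSpace (LinearMap.ker q.toLinearMap) :=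
    (q.isClosed_ker).completeSpace_coe
  obtain ⟨C, hC, hCy⟩ := (j.codRestrict _ hmem).exists_preimage_norm_le (by
    rintro ⟨e, he⟩
    obtain ⟨y, hy⟩ := (hex e).1 he
    exact ⟨y, Subtype.ext hy⟩)
  refine ⟨C, hC.le, fun y => ?_⟩
  obtain ⟨y', hy', hn⟩ := hCy ⟨j y, hmem y⟩
  have : y' = y := hj (congrArg Subtype.val hy')
  subst this
  exact hn

theorem IsMetricProjection.exists_bound {X : Type*} [NormedAddCommGroup X] [NormedSpace ℝ X]
    {m : ZLinear X ℝ → Module.Dual ℝ X} (hm : IsMetricProjection m) :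
    ∃ lam : ℝ, ∀ (F : ZLinear X ℝ) (x : X), |F.1 x - m F x| ≤ lam * zConst F.1 * ‖x‖ := by
  obtain ⟨lam, h⟩ := hm
  refine ⟨lam, fun F x => ?_⟩
  by_cases hx : x = 0
  · have : F.1 0 = 0 := by simpa using F.2.1 0 0
    simp [hx, this]
  · have hx' : 0 < ‖x‖ := norm_pos_iff.2 hx
    have h1 := h F (‖x‖⁻¹ • x) (by simp [norm_smul, hx])
    rw [F.2.1, map_smul, ← smul_sub, smul_eq_mul, abs_mul, abs_of_pos (inv_pos.2 hx')] at h1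
    rwa [inv_mul_le_iff₀ hx', mul_comm] at h1

theorem zConst_le {X Y : Type*} [NormedAddCommGroup X] [NormedAddCommGroup Y] [NormedSpace ℝ X]
    [NormedSpace ℝ Y] {F : X → Y} {C : ℝ} (hC : 0 ≤ C) (h : ZBound F C) : zConst F ≤ C :=
  csInf_le ⟨0, fun _ h => h.1⟩ ⟨hC, h⟩

theorem zConst_nonneg {X Y : Type*} [NormedAddCommGroup X] [NormedAddCommGroup Y]
    [NormedSpace ℝ X] [NormedSpace ℝ Y] (F : X → Y) : 0 ≤ zConst F :=
  Real.sInf_nonneg fun _ h => h.1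

/-- The coordinates of a z-linear map into `c₀` form a bounded sequence in `Z(X, ℝ)` that is
pointwise null. Continuity at `0` makes their linear approximations pointwise null too, so these
assemble into a linear map into `c₀` at finite distance from the original map. -/
theorem extEqZero_c0_of_admitsMetricProjection {X : Type*} [NormedAddCommGroup X]
    [NormedSpace ℝ X] [CompleteSpace X] (h : AdmitsMetricProjectionWStarContAtZero X) :
    ExtEqZero X c0 := by
  intro E _ _ _ j q hjq
  obtain ⟨m, hm, hcont⟩ := h
  obtain ⟨lam, hlam⟩ := hm.exists_bound
  have hjq' := hjq
  obtain ⟨hj, hex, hq⟩ := hjq'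
  obtain ⟨B, C, hC, hqB, hBn, hBc⟩ := exists_homogeneous_rightInverse q hq
  obtain ⟨K, hK, hjK⟩ := exists_norm_le_of_isShortExact hjq
  -- `L` is linear but possibly unbounded. Being linear, it cancels from the z-linearity estimate of
  -- `F = B - L`.
  obtain ⟨L, hL⟩ := q.toLinearMap.exists_rightInverse_of_surjective (LinearMap.range_eq_top.2 hq)
  have hqL (x : X) : q (L x) = x := LinearMap.congr_fun hL x
  have hF (x : X) : ∃ y, j y = B x - L x := (hex _).1 (by simp [hqB, hqL])
  choose F hF using hF
  have hFc (c : ℝ) (x : X) : F (c • x) = c • F x := hj (by simp [hF, hBc, smul_sub])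
  have hFz : ZBound F (K * (2 * C)) := by
    intro n z
    refine (hjK _).trans ?_
    rw [mul_assoc]
    gcongr
    have h1 : j (F (∑ i, z i) - ∑ i, F (z i)) = B (∑ i, z i) - ∑ i, B (z i) := by
      simp only [map_sub, map_sum, hF, Finset.sum_sub_distrib]
      abel
    rw [h1]
    refine (norm_sub_le _ _).trans ?_
    have h2 : ‖B (∑ i, z i)‖ ≤ C * ∑ i, ‖z i‖ :=
      (hBn _).trans (by gcongr; exact norm_sum_le _ _)
    have h3 : ‖∑ i, B (z i)‖ ≤ C * ∑ i, ‖z i‖ := by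
      rw [Finset.mul_sum]
      exact norm_sum_le_of_le _ fun i _ => hBn _
    linarith
  obtain ⟨D, hD, hFD⟩ : ∃ D : ℝ, 0 < D ∧ ZBound F D := by
    refine ⟨K * (2 * C) + 1, by positivity, fun n z => (hFz n z).trans ?_⟩
    gcongr
    linarith
  have happly (f : c0) (n : ℕ) : |f n| ≤ ‖f‖ := by
    have := f.toBCF.norm_coe_le_norm n
    rwa [ZeroAtInftyContinuousMap.norm_toBCF_eq_norm] at this
  have hGz (k : ℕ) : ZBound (fun x => D⁻¹ * F x k) 1 := by
    intro n z
    have h1 := (happly (F (∑ i, z i) - ∑ i, F (z i)) k).trans (hFD n z)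
    have hsum : (∑ i, F (z i)) k = ∑ i, F (z i) k := by
      let ev : c0 →+ ℝ := { toFun := fun f => f k, map_zero' := rfl, map_add' := fun _ _ => rfl }
      exact map_sum ev _ _
    rw [ZeroAtInftyContinuousMap.sub_apply, hsum] at h1
    rw [← Finset.mul_sum, ← mul_sub, Real.norm_eq_abs, abs_mul, abs_of_pos (inv_pos.2 hD),
      inv_mul_le_iff₀ hD]
    linarith
  let G : ℕ → ZLinear X ℝ := fun k => ⟨fun x => D⁻¹ * F x k, fun c x => by
    simp [hFc]; ring, 1, hGz k⟩
  have hG0 : Filter.Tendsto G Filter.atTop (𝓝 0) := by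
    rw [tendsto_subtype_rng, tendsto_pi_nhds]
    intro x
    have h1 : Filter.Tendsto (fun k => F x k) Filter.atTop (𝓝 0) := by
      have := (F x).zero_at_infty'
      rwa [Filter.cocompact_eq_cofinite, Nat.cofinite_eq_atTop] at this
    simpa using h1.const_mul D⁻¹
  have hm0 (x : X) : m 0 x = 0 := by
    have hz : zConst ((0 : ZLinear X ℝ) : X → ℝ) = 0 :=
      le_antisymm (zConst_le le_rfl fun n z => by simp) (zConst_nonneg _)
    have := hlam 0 x
    rw [hz] at this
    simpa using this
  have hmG (x : X) : Filter.Tendsto (fun k => m (G k) x) Filter.atTop (𝓝 0) := by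
    have h1 := hcont.tendsto.comp (tendsto_nhdsWithin_iff.2
      ⟨hG0, Filter.Eventually.of_forall fun k => zConst_le zero_le_one (hGz k)⟩)
    rw [tendsto_pi_nhds] at h1
    simpa [hm0] using h1 x
  let l : X →ₗ[ℝ] c0 :=
    { toFun := fun x => ⟨⟨fun k => D * m (G k) x, continuous_of_discreteTopology⟩, by
        rw [Filter.cocompact_eq_cofinite, Nat.cofinite_eq_atTop]
        simpa using (hmG x).const_mul D⟩
      map_add' := fun x y => by
        ext k
        change D * m (G k) (x + y) = D * m (G k) x + D * m (G k) y
        rw [map_add, mul_add]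
      map_smul' := fun c x => by
        ext k
        change D * m (G k) (c • x) = c * (D * m (G k) x)
        rw [map_smul, smul_eq_mul]
        ring }
  have hl (x : X) (k : ℕ) : l x k = D * m (G k) x := rfl
  have hFl (x : X) : ‖F x - l x‖ ≤ D * |lam| * ‖x‖ := by
    rw [← ZeroAtInftyContinuousMap.norm_toBCF_eq_norm,
      BoundedContinuousFunction.norm_le (by positivity)]
    intro k
    change ‖F x k - l x k‖ ≤ _
    have h1 : F x k - l x k = D * ((G k).1 x - m (G k) x) := by
      rw [hl, mul_sub]
      simp only [G]
      field_simp
    rw [h1, norm_mul, Real.norm_of_nonneg hD.le, mul_assoc]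
    gcongr
    refine (hlam (G k) x).trans ?_
    gcongr
    calc lam * zConst (G k).1 ≤ |lam| * 1 := by
          gcongr
          · exact zConst_nonneg _
          · exact le_abs_self _
          · exact zConst_le zero_le_one (hGz k)
      _ = |lam| := mul_one _
  -- The sum `L + j l` is linear, and it is bounded because it equals `B - j (F - l)`.
  let s : X →L[ℝ] E := (L + j.toLinearMap.comp l).mkContinuous (C + ‖j‖ * (D * |lam|)) (by
    intro x
    have h1 : (L + j.toLinearMap.comp l) x = B x - j (F x - l x) := by
      simp only [LinearMap.add_apply, LinearMap.comp_apply, ContinuousLinearMap.coe_coe, map_sub, hF]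
      abel
    rw [h1, add_mul]
    refine (norm_sub_le _ _).trans (add_le_add (hBn x) ?_)
    refine (j.le_opNorm _).trans ?_
    rw [mul_assoc]
    gcongr
    exact hFl x)
  refine splits_of_section hjq s fun x => ?_
  change q (L x + j (l x)) = x
  have : q (j (l x)) = 0 := (hex _).2 ⟨_, rfl⟩
  rw [map_add, hqL, this, add_zero]

end MetricProjection

/-- The Banach space `ℓ_∞(I)`. -/
abbrev lInf (I : Type*) : Type _ := lp (fun _ : I => ℝ) ⊤

/-! ### Injectivity of `ℓ_∞(I)` and projectivity of `ℓ₁(Γ)`. -/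

section Sequences

theorem exists_clm_lInf {I X : Type*} [NormedAddCommGroup X] [NormedSpace ℝ X]
    (φ : I → X →ₗ[ℝ] ℝ) (C : ℝ) (hC : ∀ i x, |φ i x| ≤ C * ‖x‖) :
    ∃ T : X →L[ℝ] lInf I, ∀ x i, T x i = φ i x := by
  have hmem (x : X) : Memℓp (fun i => φ i x) ⊤ := by
    refine memℓp_infty ⟨C * ‖x‖, ?_⟩
    rintro _ ⟨i, rfl⟩
    exact hC i x
  let T : X →ₗ[ℝ] lInf I :=
    { toFun := fun x => ⟨fun i => φ i x, hmem x⟩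
      map_add' := fun x y => by ext i; exact map_add _ _ _
      map_smul' := fun c x => by ext i; exact map_smul _ _ _ }
  refine ⟨T.mkContinuous |C| fun x => ?_, fun x i => rfl⟩
  refine lp.norm_le_of_forall_le (by positivity) fun i => (hC i x).trans ?_
  gcongr
  exact le_abs_self C

theorem lInf_abs_apply_le {I : Type*} (f : lInf I) (i : I) : |f i| ≤ ‖f‖ :=
  lp.norm_apply_le_norm ENNReal.top_ne_zero f i

/-- Injectivity of `ℓ_∞(I)`. -/
theorem exists_extension_lInf {I X : Type*} [NormedAddCommGroup X] [NormedSpace ℝ X]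
    (p : Submodule ℝ X) (ψ : p →L[ℝ] lInf I) :
    ∃ Ψ : X →L[ℝ] lInf I, ∀ x : p, Ψ x = ψ x := by
  let φ (i : I) : p →L[ℝ] ℝ := LinearMap.mkContinuous
    { toFun := fun x => ψ x i
      map_add' := fun x y => by simp
      map_smul' := fun c x => by simp } ‖ψ‖
    fun x => (lInf_abs_apply_le (ψ x) i).trans (ψ.le_opNorm x)
  have hφ (i : I) : ‖φ i‖ ≤ ‖ψ‖ := LinearMap.mkContinuous_norm_le _ (norm_nonneg ψ) _
  -- Hahn–Banach in each coordinate; preservation of norms keeps the extensions uniformly bounded.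
  choose g hg hgn using fun i => exists_extension_norm_eq p (φ i)
  obtain ⟨Ψ, hΨ⟩ := exists_clm_lInf (fun i => (g i).toLinearMap) ‖ψ‖ fun i x => by
    refine ((g i).le_opNorm x).trans ?_
    rw [hgn]
    gcongr
    exact hφ i
  refine ⟨Ψ, fun x => ?_⟩
  ext i
  rw [hΨ]
  exact hg i x

theorem exists_clm_l1 {Γ V : Type*} [DecidableEq Γ] [NormedAddCommGroup V] [NormedSpace ℝ V]
    [CompleteSpace V]
    (v : Γ → V) (M : ℝ) (hM : ∀ γ, ‖v γ‖ ≤ M) :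
    ∃ φ : l1 Γ →L[ℝ] V, ∀ γ, φ (lp.single 1 γ 1) = v γ := by
  have hsum (a : l1 Γ) : Summable fun γ => ‖a γ‖ := by
    simpa using (lp.memℓp a).summable (by simp)
  have hnorm (a : l1 Γ) : ‖a‖ = ∑' γ, ‖a γ‖ := by
    simpa using lp.norm_eq_tsum_rpow (p := 1) (by simp) a
  have hle (a : l1 Γ) (γ : Γ) : ‖a γ • v γ‖ ≤ ‖a γ‖ * |M| := by
    rw [norm_smul]
    gcongr
    exact (hM γ).trans (le_abs_self M)
  have hs (a : l1 Γ) : Summable fun γ => a γ • v γ :=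
    Summable.of_norm_bounded ((hsum a).mul_right |M|) (hle a)
  let φ : l1 Γ →ₗ[ℝ] V :=
    { toFun := fun a => ∑' γ, a γ • v γ
      map_add' := fun a b => by
        rw [← (hs a).tsum_add (hs b)]
        simp [add_smul]
      map_smul' := fun c a => by
        rw [RingHom.id_apply, ← (hs a).tsum_const_smul c]
        simp [smul_smul] }
  refine ⟨φ.mkContinuous |M| fun a => ?_, fun γ => ?_⟩
  · rw [hnorm, mul_comm, ← tsum_mul_right]
    exact tsum_of_norm_bounded ((hsum a).mul_right |M|).hasSum (hle a)
  · change ∑' γ', (lp.single 1 γ (1 : ℝ) : l1 Γ) γ' • v γ' = v γ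
    rw [tsum_eq_single γ]
    · simp
    · intro γ' h
      rw [lp.single_apply_ne _ _ _ h, zero_smul]

theorem exists_l1_surjective (V : Type*) [NormedAddCommGroup V] [NormedSpace ℝ V]
    [CompleteSpace V] :
    ∃ Q : l1 (Metric.closedBall (0 : V) 1) →L[ℝ] V, Function.Surjective Q := by
  classical
  obtain ⟨Q, hQ⟩ := exists_clm_l1 (fun v : Metric.closedBall (0 : V) 1 => (v : V)) 1
    fun v => mem_closedBall_zero_iff.1 v.2
  refine ⟨Q, fun v => ?_⟩
  by_cases hv : v = 0
  · exact ⟨0, by simp [hv]⟩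
  · refine ⟨‖v‖ • lp.single 1 ⟨‖v‖⁻¹ • v, by simp [norm_smul, hv]⟩ 1, ?_⟩
    rw [map_smul, hQ, smul_smul, mul_inv_cancel₀ (by simpa using hv), one_smul]

/-- Projectivity of `ℓ₁(Γ)`. -/
theorem exists_lift_l1 {Γ E Z : Type*} [NormedAddCommGroup E] [NormedSpace ℝ E] [CompleteSpace E]
    [NormedAddCommGroup Z] [NormedSpace ℝ Z] [CompleteSpace Z] (p : E →L[ℝ] Z)
    (hp : Function.Surjective p) (Q : l1 Γ →L[ℝ] Z) :
    ∃ φ : l1 Γ →L[ℝ] E, p.comp φ = Q := by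
  classical
  obtain ⟨C, hC, h⟩ := p.exists_preimage_norm_le hp
  choose g hg hgn using h
  obtain ⟨φ, hφ⟩ := exists_clm_l1 (fun γ : Γ => g (Q (lp.single 1 γ 1))) (C * ‖Q‖) fun γ => by
    refine (hgn _).trans ?_
    gcongr
    refine (Q.le_opNorm _).trans ?_
    rw [lp.norm_single (by simp)]
    simp
  refine ⟨φ, ?_⟩
  refine lp.ext_continuousLinearMap (by simp) fun γ => ?_
  ext
  simp [hφ, hg]

theorem exists_c0_embedding :
    ∃ ι : c0 →L[ℝ] lInf ℕ, ∀ f n, ι f n = f n :=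
  exists_clm_lInf (fun n => ({ toFun := fun f => f n
                               map_add' := fun _ _ => rfl
                               map_smul' := fun _ _ => rfl } : c0 →ₗ[ℝ] ℝ)) 1 fun n f => by
      have := f.toBCF.norm_coe_le_norm n
      rwa [ZeroAtInftyContinuousMap.norm_toBCF_eq_norm, ← one_mul ‖f‖] at this

end Sequences

/-! ### Lifting operators when `Ext` vanishes. -/

section Lifting

/-- If `Ext(K, c₀) = 0`, every operator from `K` into the range of `π : ℓ_∞ → E`, where
`ker π = c₀`, lifts through `π`. -/
theorem ExtEqZero.exists_lift {K E : Type} [NormedAddCommGroup K] [NormedSpace ℝ K]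
    [CompleteSpace K] [NormedAddCommGroup E] [NormedSpace ℝ E]
    (hK : ExtEqZero K c0) (π : lInf ℕ →L[ℝ] E)
    (hker : ∀ f, π f = 0 ↔ Filter.Tendsto f Filter.cofinite (𝓝 0)) (φ : K →L[ℝ] E)
    (hφ : ∀ k, ∃ f, π f = φ k) : ∃ ψ : K →L[ℝ] lInf ℕ, ∀ k, π (ψ k) = φ k := by
  obtain ⟨ι, hι⟩ := exists_c0_embedding
  have hπι (f : c0) : π (ι f) = 0 := by
    rw [hker]
    have h1 := f.zero_at_infty'
    rw [Filter.cocompact_eq_cofinite] at h1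
    exact h1.congr fun n => (hι f n).symm
  -- The kernel of `d` is the pullback of `π` and `φ`, an extension of `K` by `c₀`; a section of it
  -- is a lift of `φ`.
  let d : lInf ℕ × K →L[ℝ] E :=
    π.comp (ContinuousLinearMap.fst ℝ _ _) - φ.comp (ContinuousLinearMap.snd ℝ _ _)
  have hd (a : lInf ℕ × K) : a ∈ LinearMap.ker d.toLinearMap ↔ π a.1 = φ a.2 := by
    rw [LinearMap.mem_ker]
    exact sub_eq_zero
  let P := LinearMap.ker d.toLinearMap
  have : CompleteSpace P := d.isClosed_ker.completeSpace_coe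
  let j : c0 →L[ℝ] P :=
    ((ContinuousLinearMap.inl ℝ (lInf ℕ) K).comp ι).codRestrict P fun f => by
      rw [hd]
      simp [hπι]
  let q : P →L[ℝ] K := (ContinuousLinearMap.snd ℝ (lInf ℕ) K).comp P.subtypeL
  have hjq : IsShortExact j q := by
    refine ⟨fun f g hfg => ?_, fun a => ⟨fun ha => ?_, ?_⟩, fun k => ?_⟩
    · have h1 : ι f = ι g := congrArg (fun a : P => a.1.1) hfg
      ext n
      rw [← hι, ← hι, h1]
    · obtain ⟨⟨f, k⟩, hfk⟩ := a
      obtain rfl : k = 0 := ha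
      have h1 := (hd _).1 hfk
      rw [map_zero] at h1
      refine ⟨⟨⟨f, continuous_of_discreteTopology⟩, ?_⟩, ?_⟩
      · rw [Filter.cocompact_eq_cofinite]
        exact (hker f).1 h1
      · refine Subtype.ext (Prod.ext ?_ rfl)
        ext n
        exact hι _ n
    · rintro ⟨f, rfl⟩
      rfl
    · obtain ⟨f, hf⟩ := hφ k
      exact ⟨⟨(f, k), (hd _).2 hf⟩, rfl⟩
  obtain ⟨T, hTj, hTq⟩ := hK P j q hjq
  have hTj' (f : c0) : T (j f) = (f, 0) := DFunLike.congr_fun hTj f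
  have hTq' (a : P) : (T a).2 = q a := DFunLike.congr_fun hTq a
  have hinj : Function.Injective T := by
    rw [injective_iff_map_eq_zero]
    intro a ha
    obtain ⟨f, rfl⟩ := (hjq.2.1 a).1 (by rw [← hTq', ha]; rfl)
    rw [hTj'] at ha
    obtain rfl : f = 0 := (Prod.ext_iff.1 ha).1
    exact map_zero j
  have hsurj : Function.Surjective T := by
    rintro ⟨f, k⟩
    obtain ⟨a, ha⟩ := hjq.2.2 k
    refine ⟨a + j (f - (T a).1), ?_⟩
    rw [map_add, hTj']
    refine Prod.ext ?_ ?_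
    · simp
    · simp [hTq', ha]
  let S := ContinuousLinearEquiv.ofBijective T (LinearMap.ker_eq_bot.2 hinj)
    (LinearMap.range_eq_top.2 hsurj)
  let s : K →L[ℝ] P := S.symm.toContinuousLinearMap.comp (ContinuousLinearMap.inr ℝ c0 K)
  have hs (k : K) : q (s k) = k := by
    rw [← hTq']
    have : T (s k) = (0, k) := S.apply_symm_apply (0, k)
    rw [this]
  refine ⟨((ContinuousLinearMap.fst ℝ (lInf ℕ) K).comp P.subtypeL).comp s, fun k => ?_⟩
  have h1 := (hd (s k).1).1 (s k).2
  have h2 : (s k).1.2 = k := hs k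
  rw [h2] at h1
  exact h1

theorem exists_section_of_extEqZero_ker {E Z Γ : Type} [NormedAddCommGroup E] [NormedSpace ℝ E]
    [CompleteSpace E] [NormedAddCommGroup Z] [NormedSpace ℝ Z] [CompleteSpace Z]
    (π : lInf ℕ →L[ℝ] E) (hker : ∀ f, π f = 0 ↔ Filter.Tendsto f Filter.cofinite (𝓝 0))
    (p : E →L[ℝ] Z) (hp : Function.Surjective p) (hex : Function.Exact π p)
    (Q : l1 Γ →L[ℝ] Z) (hQ : Function.Surjective Q)
    (hExt : ExtEqZero (LinearMap.ker Q.toLinearMap) c0) :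
    ∃ s : Z →L[ℝ] E, ∀ z, p (s z) = z := by
  obtain ⟨φ, hφ⟩ := exists_lift_l1 p hp Q
  have hφ' (a : l1 Γ) : p (φ a) = Q a := DFunLike.congr_fun hφ a
  have hpπ (f : lInf ℕ) : p (π f) = 0 := (hex _).2 ⟨f, rfl⟩
  have : CompleteSpace (LinearMap.ker Q.toLinearMap) := Q.isClosed_ker.completeSpace_coe
  obtain ⟨ψ, hψ⟩ := hExt.exists_lift π hker (φ.comp (LinearMap.ker Q.toLinearMap).subtypeL)
    fun k => (hex _).1 ((hφ' k).trans k.2)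
  obtain ⟨Ψ, hΨ⟩ := exists_extension_lInf _ ψ
  -- Still a lift of `Q`, but now vanishing on `ker Q`, so it factors through `Z` and the factor is
  -- the section.
  let θ : l1 Γ →L[ℝ] E := φ - π.comp Ψ
  have hpθ (a : l1 Γ) : p (θ a) = Q a := by simp [θ, hφ', hpπ]
  have hθ (a : l1 Γ) (ha : Q a = 0) : θ a = 0 := by
    have h1 := hψ ⟨a, ha⟩
    rw [← hΨ] at h1
    simp only [ContinuousLinearMap.comp_apply, Submodule.subtypeL_apply] at h1
    simp [θ, h1]
  obtain ⟨C, hC, h⟩ := Q.exists_preimage_norm_le hQ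
  choose g hg hgn using h
  let s : Z →ₗ[ℝ] E :=
    { toFun := fun z => θ (g z)
      map_add' := fun x y => by
        rw [← sub_eq_zero, ← map_add, ← map_sub]
        exact hθ _ (by simp [hg])
      map_smul' := fun c x => by
        rw [← sub_eq_zero, RingHom.id_apply, ← map_smul, ← map_sub]
        exact hθ _ (by simp [hg]) }
  refine ⟨s.mkContinuous (‖θ‖ * C) fun z => ?_, fun z => ?_⟩
  · refine (θ.le_opNorm _).trans ?_
    rw [mul_assoc]
    gcongr
    exact hgn z
  · exact (hpθ _).trans (hg z)

end Lifting

/-! ### Rosenthal's disjointification and a count of values. -/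

section Disjointification

/-- Rosenthal's disjointification lemma, for superadditive set functions. -/
theorem exists_injective_disjointified {Γ : Type*} (g : Γ × Γ ≃ Γ) {ε : ℝ} (n : ℕ)
    (N : Γ → Set Γ → ℝ) (h0 : ∀ i S, 0 ≤ N i S)
    (hN : ∀ i S T, Disjoint S T → N i S + N i T ≤ N i (S ∪ T))
    (hn : ∀ i, N i Set.univ < n * ε) :
    ∃ e : Γ → Γ, Function.Injective e ∧ ∀ i, N (e i) (Set.range e \ {e i}) < ε := by
  induction n generalizing N with
  | zero =>
    refine ⟨id, Function.injective_id, fun i => absurd (hn i) ?_⟩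
    simpa using h0 i _
  | succ n ih =>
    -- `g` cuts `Γ` into rows of full size. If no row works, pick a bad point in each: the rest of
    -- its row has mass at least `ε` and misses all picked points, so restricting to these lowers
    -- the total mass by `ε`.
    by_cases h : ∃ a, ∀ b, N (g (a, b)) (Set.range (fun b => g (a, b)) \ {g (a, b)}) < ε
    · obtain ⟨a, ha⟩ := h
      exact ⟨fun b => g (a, b), fun b b' hb => (Prod.ext_iff.1 (g.injective hb)).2, ha⟩
    · push Not at h
      choose b hb using h
      let e₁ : Γ → Γ := fun a => g (a, b a)
      have he₁ : Function.Injective e₁ := fun a a' ha => (Prod.ext_iff.1 (g.injective ha)).1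
      have hmono (i : Γ) {S T : Set Γ} (hST : S ⊆ T) : N i S ≤ N i T := by
        have h1 := hN i S (T \ S) Set.disjoint_sdiff_right
        rw [Set.union_sdiff_cancel hST] at h1
        linarith [h0 i (T \ S)]
      obtain ⟨e₂, he₂, h₂⟩ := ih (fun a S => N (e₁ a) (e₁ '' S)) (fun a S => h0 _ _)
        (fun a S T hST => by
          rw [Set.image_union]
          exact hN _ _ _ ((Set.disjoint_image_iff he₁).2 hST))
        (fun a => by
          have hdisj : Disjoint (e₁ '' Set.univ)
              (Set.range (fun b => g (a, b)) \ {g (a, b a)}) := by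
            rw [Set.disjoint_left]
            rintro _ ⟨a', -, rfl⟩ ⟨⟨c, hc⟩, hne⟩
            have h1 : a = a' := (Prod.ext_iff.1 (g.injective hc)).1
            subst h1
            exact hne rfl
          have h1 := hN (e₁ a) _ _ hdisj
          have h2 := hmono (e₁ a) (Set.subset_univ
            (e₁ '' Set.univ ∪ Set.range (fun b => g (a, b)) \ {g (a, b a)}))
          have h3 := hn (e₁ a)
          have h4 : ε ≤ N (e₁ a) (Set.range (fun b => g (a, b)) \ {g (a, b a)}) := hb a
          push_cast at h3
          linarith)
      refine ⟨e₁ ∘ e₂, he₁.comp he₂, fun i => ?_⟩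
      have h1 : Set.range (e₁ ∘ e₂) \ {(e₁ ∘ e₂) i} = e₁ '' (Set.range e₂ \ {e₂ i}) := by
        rw [Set.image_sdiff he₁, Set.image_singleton, Set.range_comp]
        rfl
      rw [h1]
      exact h₂ i

/-- The indicator function of a set as an element of `ℓ_∞`. -/
noncomputable def lInfIndicator {Γ : Type*} (S : Set Γ) : lInf Γ :=
  ⟨S.indicator 1, memℓp_infty ⟨1, by
    classical
    rintro _ ⟨i, rfl⟩
    by_cases h : i ∈ S <;> simp [h]⟩⟩

theorem lInfIndicator_apply {Γ : Type*} (S : Set Γ) (x : Γ) :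
    lInfIndicator S x = S.indicator 1 x := rfl

/-- The norm of the functional `f ↦ T f i` on the subspace `ℓ_∞(S)` of `ℓ_∞(Γ)`. -/
noncomputable def normOn {Γ I : Type*} (T : lInf Γ →L[ℝ] lInf I) (i : I) (S : Set Γ) : ℝ :=
  sSup {r | ∃ f : lInf Γ, ‖f‖ ≤ 1 ∧ (∀ x ∉ S, f x = 0) ∧ T f i = r}

section normOn

variable {Γ I : Type*} (T : lInf Γ →L[ℝ] lInf I) (i : I)

theorem apply_le_opNorm {f : lInf Γ} (hf : ‖f‖ ≤ 1) : T f i ≤ ‖T‖ :=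
  (le_abs_self _).trans <| (lInf_abs_apply_le _ i).trans <| (T.le_opNorm f).trans <|
    mul_le_of_le_one_right (norm_nonneg _) hf

theorem apply_le_normOn {f : lInf Γ} (hf : ‖f‖ ≤ 1) {S : Set Γ} (hS : ∀ x ∉ S, f x = 0) :
    T f i ≤ normOn T i S := by
  refine le_csSup ⟨‖T‖, ?_⟩ ⟨f, hf, hS, rfl⟩
  rintro _ ⟨f, hf, -, rfl⟩
  exact apply_le_opNorm T i hf

theorem normOn_nonneg (S : Set Γ) : 0 ≤ normOn T i S := by
  simpa using apply_le_normOn T i (f := 0) (by simp) (S := S) (by simp)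

theorem normOn_le {S : Set Γ} {C : ℝ}
    (h : ∀ f : lInf Γ, ‖f‖ ≤ 1 → (∀ x ∉ S, f x = 0) → T f i ≤ C) : normOn T i S ≤ C := by
  refine csSup_le ⟨_, 0, by simp, by simp, rfl⟩ ?_
  rintro _ ⟨f, hf, hS, rfl⟩
  exact h f hf hS

/-- Disjointly supported elements of the unit ball have their sum in the unit ball. -/
theorem normOn_add_le {S S' : Set Γ} (hd : Disjoint S S') :
    normOn T i S + normOn T i S' ≤ normOn T i (S ∪ S') := by
  rw [← le_sub_iff_add_le]
  refine normOn_le T i fun f hf hfS => ?_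
  rw [le_sub_comm]
  refine normOn_le T i fun f' hf' hfS' => ?_
  rw [le_sub_iff_add_le, add_comm]
  have h1 : T f i + T f' i = T (f + f') i := by simp
  rw [h1]
  refine apply_le_normOn T i (lp.norm_le_of_forall_le zero_le_one fun x => ?_) fun x hx => ?_
  · rw [Real.norm_eq_abs, lp.coeFn_add, Pi.add_apply]
    by_cases hx : x ∈ S
    · rw [hfS' x (Set.disjoint_left.1 hd hx), add_zero]
      exact (lInf_abs_apply_le f x).trans hf
    · rw [hfS x hx, zero_add]
      exact (lInf_abs_apply_le f' x).trans hf'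
  · rw [Set.mem_union, not_or] at hx
    simp [hfS x hx.1, hfS' x hx.2]

end normOn

/-- An operator on `ℓ_∞(Γ)` that is bounded below on the unit vectors by point evaluations has
at least as many values as `Γ` has subsets. -/
theorem mk_set_le_mk_range {Γ I : Type} [DecidableEq Γ] (g : Γ × Γ ≃ Γ)
    (T : lInf Γ →L[ℝ] lInf I) (u : Γ → I) (hT : ∀ x, T (lp.single ⊤ x 1) (u x) = 1) :
    Cardinal.mk (Set Γ) ≤ Cardinal.mk (Set.range T) := by
  obtain ⟨n, hn⟩ := exists_nat_gt ‖T‖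
  obtain ⟨e, he, hN⟩ := exists_injective_disjointified g (ε := 1) n (fun x S => normOn T (u x) S)
    (fun x S => normOn_nonneg T _ S) (fun x S S' hd => normOn_add_le T _ hd)
    fun x => by
      rw [mul_one]
      exact (normOn_le T _ fun f hf _ => apply_le_opNorm T _ hf).trans_lt hn
  refine Cardinal.mk_le_of_injective
    (f := fun S : Set Γ => (⟨T (lInfIndicator (e '' S)), _, rfl⟩ : Set.range T)) ?_
  intro S S' hSS
  have hTT : T (lInfIndicator (e '' S)) = T (lInfIndicator (e '' S')) := congrArg Subtype.val hSS
  by_contra hne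
  obtain ⟨i, hi⟩ : ∃ i, ¬ (i ∈ S ↔ i ∈ S') := by
    by_contra! h
    exact hne (Set.ext h)
  let f : lInf Γ := lInfIndicator (e '' S) - lInfIndicator (e '' S')
  have hTf : T f = 0 := by simp [f, hTT]
  have hf (x : Γ) : f x = (e '' S).indicator 1 x - (e '' S').indicator 1 x := rfl
  have hfle (x : Γ) : |f x| ≤ 1 := by
    rw [hf]
    by_cases h1 : x ∈ e '' S <;> by_cases h2 : x ∈ e '' S' <;>
      simp only [Set.indicator_of_mem, Set.indicator_of_notMem, h1, h2, not_false_eq_true,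
        Pi.one_apply] <;> norm_num
  have hfi : |f (e i)| = 1 := by
    rw [hf]
    have h1 : e i ∈ e '' S ↔ i ∈ S := he.mem_set_image
    have h2 : e i ∈ e '' S' ↔ i ∈ S' := he.mem_set_image
    by_cases h3 : i ∈ S <;> by_cases h4 : i ∈ S' <;>
      simp [Set.indicator, h1, h2, h3, h4] at hi ⊢
  have hf0 (x : Γ) (hx : x ∉ Set.range e) : f x = 0 := by
    rw [hf, Set.indicator_of_notMem, Set.indicator_of_notMem, sub_self]
    · exact fun h => hx (Set.image_subset_range _ _ h)
    · exact fun h => hx (Set.image_subset_range _ _ h)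
  -- As `T f = 0`, deleting the coordinate `e i` leaves a value of modulus `1` at `u (e i)`, though
  -- `h` lives on the set where `normOn` is below `1`.
  let h : lInf Γ := f - f (e i) • lp.single ⊤ (e i) 1
  have hh (x : Γ) : h x = if x = e i then 0 else f x := by
    have h1 : h x = f x - f (e i) * (lp.single ⊤ (e i) (1 : ℝ) : lInf Γ) x := rfl
    rw [h1]
    split_ifs with hx
    · rw [hx, lp.single_apply_self, mul_one, sub_self]
    · rw [lp.single_apply_ne _ _ _ hx, mul_zero, sub_zero]
  have hhn : ‖h‖ ≤ 1 := lp.norm_le_of_forall_le zero_le_one fun x => by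
    rw [hh, Real.norm_eq_abs]
    split_ifs
    · simp
    · exact hfle x
  have hh0 (x : Γ) (hx : x ∉ Set.range e \ {e i}) : h x = 0 := by
    rw [hh]
    split_ifs with hxe
    · rfl
    · exact hf0 x fun hxr => hx ⟨hxr, hxe⟩
  have hTh : T h (u (e i)) = - f (e i) := by
    have h1 : T h = T f - f (e i) • T (lp.single ⊤ (e i) 1) := by simp [h]
    have h2 : T h (u (e i)) = T f (u (e i)) - f (e i) * T (lp.single ⊤ (e i) 1) (u (e i)) := by
      rw [h1]
      rfl
    rw [h2, hTf, hT, mul_one]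
    exact zero_sub _
  have h1 : |T h (u (e i))| ≤ normOn T (u (e i)) (Set.range e \ {e i}) := by
    refine abs_le'.2 ⟨apply_le_normOn T _ hhn hh0, ?_⟩
    have := apply_le_normOn T (u (e i)) (f := -h) (by rwa [norm_neg])
      (S := Set.range e \ {e i}) (fun x hx => by simp [hh0 x hx])
    simpa using this
  rw [hTh, abs_neg, hfi] at h1
  exact absurd (hN i) (not_lt.2 h1)

end Disjointification

/-! ### The copy of `ℓ_∞/c₀` inside `ℓ_∞(ℕ*)`. -/

section FreeUltrafilters

/-- The free ultrafilters on `ℕ`. -/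
abbrev FreeUltrafilter : Type := {U : Ultrafilter ℕ // (U : Filter ℕ) ≤ Filter.cofinite}

theorem exists_tendsto_ultrafilter (U : Ultrafilter ℕ) (f : lInf ℕ) :
    ∃ a, Filter.Tendsto f U (𝓝 a) := by
  obtain ⟨a, -, ha⟩ := (isCompact_Icc (a := -‖f‖) (b := ‖f‖)).ultrafilter_le_nhds (U.map f) (by
    rw [Filter.le_principal_iff]
    exact Filter.mem_map.2 (Filter.Eventually.of_forall fun n => abs_le.1 (lInf_abs_apply_le f n)))
  exact ⟨a, ha⟩

theorem exists_limit_clm :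
    ∃ π : lInf ℕ →L[ℝ] lInf FreeUltrafilter,
      ∀ (f : lInf ℕ) (U : FreeUltrafilter), Filter.Tendsto f (U.1 : Filter ℕ) (𝓝 (π f U)) := by
  choose l hl using exists_tendsto_ultrafilter
  obtain ⟨π, hπ⟩ := exists_clm_lInf (fun U : FreeUltrafilter =>
    ({ toFun := l U.1
       map_add' := fun f g => tendsto_nhds_unique (hl U.1 (f + g)) ((hl _ f).add (hl _ g))
       map_smul' := fun c f => tendsto_nhds_unique (hl U.1 (c • f)) ((hl _ f).const_mul c) } :
      lInf ℕ →ₗ[ℝ] ℝ)) 1 fun U f => by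
      rw [one_mul]
      exact le_of_tendsto (hl U.1 f).abs (Filter.Eventually.of_forall (lInf_abs_apply_le f))
  exact ⟨π, fun f U => by rw [hπ]; exact hl _ _⟩

variable {π : lInf ℕ →L[ℝ] lInf FreeUltrafilter}

theorem limit_eq_zero_iff
    (hπ : ∀ (f : lInf ℕ) (U : FreeUltrafilter), Filter.Tendsto f (U.1 : Filter ℕ) (𝓝 (π f U)))
    (f : lInf ℕ) :
    π f = 0 ↔ Filter.Tendsto f Filter.cofinite (𝓝 0) := by
  rw [Filter.tendsto_iff_ultrafilter]
  constructor
  · intro h U hU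
    have := hπ f ⟨U, hU⟩
    rwa [h] at this
  · intro h
    ext U
    exact tendsto_nhds_unique (hπ f U) (h U.1 U.2)

theorem exists_preimage_limit
    (hπ : ∀ (f : lInf ℕ) (U : FreeUltrafilter), Filter.Tendsto f (U.1 : Filter ℕ) (𝓝 (π f U)))
    (f : lInf ℕ) :
    ∃ f', π f' = π f ∧ ‖f'‖ ≤ ‖π f‖ := by
  let r := ‖π f‖
  have hr : -r ≤ r := neg_le_self (norm_nonneg _)
  -- Truncation at height `‖π f‖` leaves all limits along free ultrafilters unchanged. The resulting
  -- norm control is what makes the range of `π` closed.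
  let F : ℕ → ℝ := fun n => max (-r) (min r (f n))
  have hF (n : ℕ) : ‖F n‖ ≤ r := by
    rw [Real.norm_eq_abs, abs_le]
    exact ⟨le_max_left _ _, max_le hr (min_le_left _ _)⟩
  let f' : lInf ℕ := ⟨F, memℓp_infty ⟨r, by rintro _ ⟨n, rfl⟩; exact hF n⟩⟩
  refine ⟨f', ?_, lp.norm_le_of_forall_le (norm_nonneg _) hF⟩
  ext U
  refine tendsto_nhds_unique (hπ f' U) ?_
  have h1 : Filter.Tendsto F (U.1 : Filter ℕ) (𝓝 (max (-r) (min r (π f U)))) :=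
    tendsto_const_nhds.max (tendsto_const_nhds.min (hπ f U))
  have h2 := abs_le.1 (lInf_abs_apply_le (π f) U)
  rwa [min_eq_right h2.2, max_eq_right h2.1] at h1

theorem isClosed_range_limit
    (hπ : ∀ (f : lInf ℕ) (U : FreeUltrafilter), Filter.Tendsto f (U.1 : Filter ℕ) (𝓝 (π f U))) :
    IsClosed (LinearMap.range π.toLinearMap : Set (lInf FreeUltrafilter)) := by
  let φ : NormedAddGroupHom (lInf ℕ) (lInf FreeUltrafilter) :=
    { toFun := π, map_add' := map_add π, bound' := ⟨‖π‖, π.le_opNorm⟩ }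
  have h1 : φ.SurjectiveOnWith (LinearMap.range π.toLinearMap).toAddSubgroup 1 := by
    rintro _ ⟨f, rfl⟩
    obtain ⟨f', h, hn⟩ := exists_preimage_limit hπ f
    exact ⟨f', h, by rw [one_mul]; exact hn⟩
  have h2 := controlled_closure_of_complete zero_lt_one zero_lt_one h1
  refine isClosed_of_closure_subset fun y hy => ?_
  obtain ⟨f, hf, -⟩ := h2 y hy
  exact ⟨f, hf⟩

theorem exists_almostDisjoint :
    ∃ A : (ℕ → Bool) → Set ℕ, (∀ x, (A x).Infinite) ∧ ∀ x y, x ≠ y → (A x ∩ A y).Finite := by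
  -- Branches of the binary tree, coded by their finite initial segments; distinct branches share
  -- only finitely many.
  let c : (ℕ → Bool) → ℕ → ℕ := fun x n => Encodable.encode ((List.range n).map x)
  have hc {x y : ℕ → Bool} {m n : ℕ} (h : c x m = c y n) : m = n ∧ ∀ k < n, x k = y k := by
    have h1 := Encodable.encode_injective h
    obtain rfl : m = n := by simpa using congrArg List.length h1
    exact ⟨rfl, fun k hk => List.map_inj_left.1 h1 k (List.mem_range.2 hk)⟩
  refine ⟨fun x => Set.range (c x), fun x => Set.infinite_range_of_injective fun m n h => (hc h).1,
    fun x y hxy => ?_⟩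
  obtain ⟨k, hk⟩ := Function.ne_iff.1 hxy
  refine ((Set.finite_Iic k).image (c y)).subset ?_
  rintro _ ⟨⟨m, hm⟩, ⟨n, rfl⟩⟩
  exact ⟨n, not_lt.1 fun h => hk ((hc hm).2 k h), rfl⟩

theorem exists_freeUltrafilter_mem {A : Set ℕ} (hA : A.Infinite) :
    ∃ U : FreeUltrafilter, A ∈ U.1 := by
  have : (Filter.cofinite ⊓ Filter.principal A).NeBot := hA.cofinite_inf_principal_neBot
  have h := Ultrafilter.of_le (Filter.cofinite ⊓ Filter.principal A)
  exact ⟨⟨_, h.trans inf_le_left⟩, Filter.le_principal_iff.1 (h.trans inf_le_right)⟩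

/-- A free ultrafilter contains at most one `A x`, since pairwise intersections are finite; so `g`
can be spread with constant value `g x` over the ultrafilters containing `A x`. -/
theorem exists_clm_of_almostDisjoint {Γ : Type} {A : Γ → Set ℕ}
    (hA : ∀ x y, x ≠ y → (A x ∩ A y).Finite) :
    ∃ τ : lInf Γ →L[ℝ] lInf FreeUltrafilter, (∀ g U x, A x ∈ U.1 → τ g U = g x) ∧
      ∀ g U, (∀ x, A x ∉ U.1) → τ g U = 0 := by
  classical
  have huniq (U : FreeUltrafilter) {x y : Γ} (hx : A x ∈ U.1) (hy : A y ∈ U.1) : x = y := by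
    by_contra h
    have h1 : (A x ∩ A y)ᶜ ∈ U.1 := U.2 (hA x y h).compl_mem_cofinite
    exact Ultrafilter.compl_mem_iff_notMem.1 h1 (Filter.inter_mem hx hy)
  obtain ⟨τ, hτ⟩ := exists_clm_lInf (fun U : FreeUltrafilter =>
    if h : ∃ x, A x ∈ U.1 then
      ({ toFun := fun g => g h.choose
         map_add' := fun _ _ => rfl
         map_smul' := fun _ _ => rfl } : lInf Γ →ₗ[ℝ] ℝ) else 0) 1 fun U g => by
      rw [one_mul]
      split_ifs
      · exact lInf_abs_apply_le g _
      · simp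
  refine ⟨τ, fun g U x hx => ?_, fun g U h => ?_⟩
  · have h : ∃ x, A x ∈ U.1 := ⟨x, hx⟩
    rw [hτ, dif_pos h]
    change g h.choose = g x
    rw [huniq U h.choose_spec hx]
  · rw [hτ, dif_neg (by push Not; exact h)]
    rfl

end FreeUltrafilters

/-! ### Cardinality bounds. -/

section Cardinality

theorem mk_le_continuum_of_separable (X : Type) [MetricSpace X]
    [TopologicalSpace.SeparableSpace X] : Cardinal.mk X ≤ Cardinal.continuum := by
  rcases isEmpty_or_nonempty X with h | h
  · simp
  have h1 (x : X) (n : ℕ) : ∃ k, dist (TopologicalSpace.denseSeq X k) x < 1 / (n + 1) := by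
    obtain ⟨k, hk⟩ := (TopologicalSpace.denseRange_denseSeq X).exists_dist_lt x
      (Nat.one_div_pos_of_nat (n := n) (α := ℝ))
    exact ⟨k, by rwa [dist_comm]⟩
  choose k hk using h1
  have hlim (x : X) : Filter.Tendsto (fun n => TopologicalSpace.denseSeq X (k x n)) Filter.atTop
      (𝓝 x) := by
    rw [tendsto_iff_dist_tendsto_zero]
    exact squeeze_zero (fun n => dist_nonneg) (fun n => (hk x n).le)
      tendsto_one_div_add_atTop_nhds_zero_nat
  have hinj : Function.Injective k := fun x y hxy => by
    have h2 := hlim x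
    rw [hxy] at h2
    exact tendsto_nhds_unique h2 (hlim y)
  simpa using Cardinal.mk_le_of_injective hinj

theorem mk_lInf_nat_le : Cardinal.mk (lInf ℕ) ≤ Cardinal.continuum := by
  have h : Function.Injective (fun (f : lInf ℕ) (n : ℕ) => f n) := fun f g hfg => lp.ext hfg
  refine (Cardinal.mk_le_of_injective h).trans ?_
  simp [Cardinal.mk_real]

theorem continuum_lt_mk_set : Cardinal.continuum < Cardinal.mk (Set (ℕ → Bool)) := by
  rw [Cardinal.mk_set]
  have : Cardinal.mk (ℕ → Bool) = Cardinal.continuum := by simp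
  rw [this]
  exact Cardinal.cantor _

end Cardinality

end BanachExt

/-! ### The space `Z` and the conclusion. -/

open BanachExt in
theorem mainTheorem3 :
    ∃ (Z : Type) (_ : NormedAddCommGroup Z) (_ : NormedSpace ℝ Z) (_ : CompleteSpace Z),
      ¬ TopologicalSpace.SeparableSpace Z ∧
      (∃ (Γ : Type) (Q : BanachExt.l1 Γ →L[ℝ] Z), Function.Surjective Q) ∧
      ∀ (Γ : Type) (Q : BanachExt.l1 Γ →L[ℝ] Z), Function.Surjective Q →
        ¬ BanachExt.ExtEqZero (LinearMap.ker Q.toLinearMap) BanachExt.c0 ∧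
        ¬ BanachExt.AdmitsMetricProjectionWStarContAtZero (LinearMap.ker Q.toLinearMap) := by
  classical
  obtain ⟨π, hπ⟩ := exists_limit_clm
  obtain ⟨A, hAinf, hAdisj⟩ := exists_almostDisjoint
  obtain ⟨τ, hτ, hτ0⟩ := exists_clm_of_almostDisjoint hAdisj
  choose u hu using fun x => exists_freeUltrafilter_mem (hAinf x)
  let R := LinearMap.range π.toLinearMap
  have hRclosed : IsClosed (R : Set (lInf FreeUltrafilter)) := isClosed_range_limit hπ
  have hRcard : Cardinal.mk R ≤ Cardinal.continuum := Cardinal.mk_range_le.trans mk_lInf_nat_le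
  let p : lInf FreeUltrafilter →L[ℝ] (lInf FreeUltrafilter ⧸ R) := R.mkQL
  have hp : Function.Surjective p := R.mkQ_surjective
  have hpR (y : lInf FreeUltrafilter) : p y = 0 ↔ y ∈ R := Submodule.Quotient.mk_eq_zero R
  have hex : Function.Exact π p := fun y => hpR y
  have hnoExt (Γ : Type) (Q : BanachExt.l1 Γ →L[ℝ] (lInf FreeUltrafilter ⧸ R))
      (hQ : Function.Surjective Q) : ¬ ExtEqZero (LinearMap.ker Q.toLinearMap) c0 := by
    intro hExt
    obtain ⟨s, hs⟩ := exists_section_of_extEqZero_ker π (limit_eq_zero_iff hπ) p hp hex Q hQ hExt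
    let P := ContinuousLinearMap.id ℝ (lInf FreeUltrafilter) - s.comp p
    have hP (y : lInf FreeUltrafilter) : P y ∈ R := by
      rw [← hpR]
      simp [P, hs]
    have hPR (y : lInf FreeUltrafilter) (hy : y ∈ R) : P y = y := by
      simp [P, (hpR y).2 hy]
    -- The image of the unit vector at `x` is the limit function of the indicator of `A x`.
    have hτR (x : ℕ → Bool) : τ (lp.single ⊤ x 1) ∈ R := by
      refine ⟨lInfIndicator (A x), ?_⟩
      ext U
      refine tendsto_nhds_unique (hπ (lInfIndicator (A x)) U) ?_
      by_cases hx : A x ∈ U.1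
      · rw [hτ _ _ x hx, lp.single_apply_self]
        refine tendsto_const_nhds.congr' ?_
        filter_upwards [hx] with n hn
        simp [lInfIndicator_apply, hn]
      · have h1 : τ (lp.single ⊤ x 1) U = 0 := by
          by_cases hU : ∃ y, A y ∈ U.1
          · obtain ⟨y, hy⟩ := hU
            rw [hτ _ _ y hy, lp.single_apply_ne]
            rintro rfl
            exact hx hy
          · exact hτ0 _ _ (by push Not at hU; exact hU)
        rw [h1]
        refine tendsto_const_nhds.congr' ?_
        filter_upwards [Ultrafilter.compl_mem_iff_notMem.2 hx] with n hn
        exact (Set.indicator_of_notMem hn _).symm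
    have hg : Nonempty ((ℕ → Bool) × (ℕ → Bool) ≃ (ℕ → Bool)) := by
      rw [← Cardinal.eq]
      simp
    have h1 := mk_set_le_mk_range hg.some (P.comp τ) u fun x => by
      rw [ContinuousLinearMap.comp_apply, hPR _ (hτR x), hτ _ _ x (hu x), lp.single_apply_self]
    have h2 : Set.range (P.comp τ) ⊆ R := by
      rintro _ ⟨g, rfl⟩
      exact hP _
    exact absurd continuum_lt_mk_set
      (not_lt.2 (h1.trans ((Cardinal.mk_le_mk_of_subset h2).trans hRcard)))
  refine ⟨lInf FreeUltrafilter ⧸ R, inferInstance, inferInstance, inferInstance, fun hsep => ?_,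
    ⟨_, exists_l1_surjective _⟩, fun Γ Q hQ => ⟨hnoExt Γ Q hQ, fun h => hnoExt Γ Q hQ ?_⟩⟩
  -- A separable quotient would have at most `𝔠` elements. As `R` does too, so would `ℓ_∞(ℕ*)`,
  -- which contains the `2^𝔠` images under `τ` of indicators.
  · have h1 := mk_le_continuum_of_separable (lInf FreeUltrafilter ⧸ R)
    choose σ hσ using hp
    have h2 : Function.Injective (fun y : lInf FreeUltrafilter =>
        ((p y, ⟨y - σ (p y), by rw [← hpR, map_sub, hσ, sub_self]⟩) :
          (lInf FreeUltrafilter ⧸ R) × R)) := by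
      intro y y' h
      obtain ⟨ha, hb⟩ := Prod.ext_iff.1 h
      have hb' : y - σ (p y) = y' - σ (p y') := congrArg Subtype.val hb
      have ha' : p y = p y' := ha
      rw [ha'] at hb'
      exact sub_left_injective hb'
    have h3 : Cardinal.mk (lInf FreeUltrafilter) ≤ Cardinal.continuum := by
      refine (Cardinal.mk_le_of_injective h2).trans ?_
      rw [Cardinal.mk_prod, Cardinal.lift_id, Cardinal.lift_id]
      exact (mul_le_mul' h1 hRcard).trans Cardinal.continuum_mul_self.le
    have h4 : Function.Injective (fun S : Set (ℕ → Bool) => τ (lInfIndicator S)) := by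
      intro S S' h
      ext x
      have h5 := congrArg (fun y : lInf FreeUltrafilter => y (u x)) h
      simp only [hτ _ _ x (hu x), lInfIndicator_apply] at h5
      by_cases hx : x ∈ S <;> by_cases hx' : x ∈ S' <;> simp [hx, hx'] at h5 ⊢
    exact absurd continuum_lt_mk_set (not_lt.2 ((Cardinal.mk_le_of_injective h4).trans h3))
  · have : CompleteSpace (LinearMap.ker Q.toLinearMap) := Q.isClosed_ker.completeSpace_coe
    exact extEqZero_c0_of_admitsMetricProjection h
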